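/- Let $-D<0$ be a fundamental discriminant and let $\chi=\left(\frac{-D}{\cdot}\right)$ be the Kronecker symbol. For $u\ge 0$ put $$\Phi(u,\chi)=4\sum_{n=1}^\infty \chi(n)\,n\,\exp\!\left(\tfrac{3u}{2}-\tfrac{n^2\pi e^{2u}}{D}\right),$$ and for real $t$ and complex $x$ put $$\Xi_t(x,\chi)=\int_0^\infty e^{tu^2}\,\Phi(u,\chi)\cos(ux)\,du ,$$ an entire function of $x$; let $'$ denote the derivative with respect to $x$. Let $$\Lambda_{-D}=\inf\{s\in\mathbb R : \text{for every real } t\ge s \text{ all zeros of } \Xi_t(\cdot,\chi)\text{ are real}\}\in[-\infty,\infty],$$ which, by theorems of de Bruijn and Newman, is the real constant $\Lambda$ with the property that $\Xi_t(\cdot,\chi)$ has only real zeros if and only if $t\ge\Lambda$. (i) If for some real $t_0$ and $x_0$ one has a double root, i.e. $\Xi_{t_0}(x_0,\chi)=0=\Xi'_{t_0}(x_0,\chi)$, then $t_0\le\Lambda_{-D}$. (ii) For every real $t>\Lambda_{-D}$ all zeros of $\Xi_t(\cdot,\chi)$ are real and simple: if $z\in\mathbb C$ and $\Xi_t(z,\chi)=0$,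 then $z\in\mathbb R$ and $\Xi'_t(z,\chi)\neq0$. -/

import Mathlib

open MeasureTheory

noncomputable section

namespace LowDiscriminant

/-- `d` is a fundamental discriminant: either `d ≡ 1 (mod 4)` is squarefree and `d ≠ 1`, or
`d = 4m` with `m` squarefree and `m ≡ 2, 3 (mod 4)`. -/
def IsFundamentalDiscriminant (d : ℤ) : Prop :=
  (d % 4 = 1 ∧ Squarefree d ∧ d ≠ 1) ∨
    ∃ m : ℤ, d = 4 * m ∧ Squarefree m ∧ (m % 4 = 2 ∨ m % 4 = 3)

/-- The Kronecker symbol `(a / n)` for a natural number `n`. For `n = 2 ^ k * b` with `b` odd it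
is `(a / 2) ^ k` times the Jacobi symbol `(a / b)`, where `(a / 2)` is `0` for even `a`, `1` for
`a ≡ ±1 (mod 8)` and `-1` for `a ≡ ±3 (mod 8)`, which is the value `ZMod.χ₈ a`. -/
def kroneckerSymbol (a : ℤ) (n : ℕ) : ℤ :=
  if n = 0 then (if a.natAbs = 1 then 1 else 0)
  else ZMod.χ₈ (a : ZMod 8) ^ padicValNat 2 n * jacobiSym a (n / 2 ^ padicValNat 2 n)

/-- `Φ(u, χ) = 4 ∑_{n ≥ 1} χ(n) n exp(3u/2 - n² π exp(2u) / D)` for the Kronecker symbol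
`χ = (-D / ·)`. The term `n = 0` of the sum vanishes. -/
def Phi (D : ℕ) (u : ℝ) : ℝ :=
  4 * ∑' n : ℕ, (kroneckerSymbol (-(D : ℤ)) n : ℝ) * (n : ℝ) *
    Real.exp (3 * u / 2 - (n : ℝ) ^ 2 * Real.pi * Real.exp (2 * u) / (D : ℝ))

/-- `Ξ_t(z, χ) = ∫_0^∞ exp(t u²) Φ(u, χ) cos(u z) du`, as a function of the complex variable
`z`. -/
def Xi (D : ℕ) (t : ℝ) (z : ℂ) : ℂ :=
  ∫ u in Set.Ioi (0 : ℝ),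
    ((Real.exp (t * u ^ 2) * Phi D u : ℝ) : ℂ) * Complex.cos ((u : ℂ) * z)

/-- All complex zeros of `f` are real. -/
def HasOnlyRealZeros (f : ℂ → ℂ) : Prop :=
  ∀ z : ℂ, f z = 0 → z.im = 0

/-- The constant `Λ_{-D}`: the threshold time from which on all zeros of `Ξ_t` are real. It is
taken in the extended reals, so that the definition presupposes neither that such a time exists
nor that these times are bounded below. -/
def newmanConstant (D : ℕ) : EReal :=
  sInf ((fun s : ℝ => (s : EReal)) '' {s : ℝ | ∀ t : ℝ, s ≤ t → HasOnlyRealZeros (Xi D t)})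

/-- A real number `Λ` such that `Ξ_t` has only real zeros if and only if `t ≥ Λ` is equal to
`newmanConstant D`. -/
theorem newmanConstant_eq_of_forall_iff (D : ℕ) (L : ℝ)
    (h : ∀ t : ℝ, HasOnlyRealZeros (Xi D t) ↔ L ≤ t) : newmanConstant D = (L : EReal) := by
  apply IsLeast.csInf_eq
  refine ⟨⟨L, fun t ht => (h t).2 ht, rfl⟩, ?_⟩
  rintro _ ⟨s, hs, rfl⟩
  exact EReal.coe_le_coe_iff.2 ((h s).1 (hs s le_rfl))

end LowDiscriminant

end

open MeasureTheory

noncomputable section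

namespace LowDiscriminant

/-! Lowering `t` by `s²` multiplies the integrand by `exp (-s² u²)`, a backward heat flow. Putting
`x = ± i s u` in the generating function `exp (x² + x v) = ∑ heatPoly n v * x ^ n` gives
`Ξ_{t-s²}(x₀ + s v) = ∑ s^k * heatPoly k v * Ξ_t^(k)(x₀)` (`hasSum_cosTransform_exp_neg_sq`). At a
zero `x₀` of order `m ≥ 2`, dividing by `s^m` and letting `s → 0` leaves `heatPoly m v *
Ξ_t^(m)(x₀)`. This polynomial has a non-real root (`exists_heatPoly_eq_zero`), so a Hurwitz argument
gives `Ξ_{t-s²}` a non-real zero for all small `s > 0` (`eventually_exists_nonreal_zero`). That is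
impossible for `t > Λ`, which is (ii); (i) follows by contraposition. -/

/-! ### Heat polynomials. -/

/-- The coefficient of `x ^ n` in the power series of `exp (x ^ 2)`. -/
def expSqCoeff (K : Type*) [Field K] (n : ℕ) : K :=
  if Even n then ((n / 2).factorial : K)⁻¹ else 0

/-- The coefficient of `x ^ n` in the power series of `exp (x ^ 2 + x * v)`, a heat polynomial
in `v`. -/
def heatPoly {K : Type*} [Field K] (n : ℕ) (v : K) : K :=
  ∑ p ∈ Finset.HasAntidiagonal.antidiagonal n, expSqCoeff K p.1 * (v ^ p.2 / (p.2.factorial : K))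

theorem hasSum_expSqCoeff {K : Type*} [RCLike K] (x : K) :
    HasSum (fun n => expSqCoeff K n * x ^ n) (NormedSpace.exp (x ^ 2)) := by
  have h := NormedSpace.expSeries_div_hasSum_exp (x ^ 2)
  have hinj : Function.Injective (fun n : ℕ => 2 * n) := fun a b hab => by
    simpa using hab
  refine (hinj.hasSum_iff ?_).1 ?_
  · intro n hn
    have : ¬ Even n := fun ⟨k, hk⟩ => hn ⟨k, by simp only; omega⟩
    simp [expSqCoeff, this]
  · refine h.congr_fun ?_
    intro n
    simp [expSqCoeff, pow_mul, div_eq_mul_inv, mul_comm, pow_right_comm]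

theorem hasSum_heatPoly {K : Type*} [RCLike K] (v x : K) :
    HasSum (fun n => heatPoly n v * x ^ n) (NormedSpace.exp (x ^ 2 + x * v)) := by
  have h₁ := hasSum_expSqCoeff x
  have h₂ := NormedSpace.expSeries_div_hasSum_exp (x * v)
  have e : ∀ n, heatPoly n v * x ^ n = ∑ p ∈ Finset.HasAntidiagonal.antidiagonal n,
      (expSqCoeff K p.1 * x ^ p.1) * ((x * v) ^ p.2 / (p.2.factorial : K)) := by
    intro n
    rw [heatPoly, Finset.sum_mul]
    refine Finset.sum_congr rfl fun p hp => ?_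
    rw [← Finset.HasAntidiagonal.mem_antidiagonal.1 hp, pow_add, mul_pow]
    ring
  have s := summable_norm_sum_mul_antidiagonal_of_summable_norm h₁.summable.norm h₂.summable.norm
  have t := tsum_mul_tsum_eq_tsum_sum_antidiagonal_of_summable_norm h₁.summable.norm
    h₂.summable.norm
  simp_rw [e]
  rw [NormedSpace.exp_add, ← h₁.tsum_eq, ← h₂.tsum_eq, t]
  exact s.of_norm.hasSum

/-- The coefficients are nonnegative, so the real heat polynomial majorizes the complex one. -/
theorem norm_heatPoly_le {n : ℕ} {v : ℂ} {R : ℝ} (hv : ‖v‖ ≤ R) :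
    ‖heatPoly n v‖ ≤ heatPoly n R := by
  refine (norm_sum_le _ _).trans (Finset.sum_le_sum fun p _ => ?_)
  have hb : ‖expSqCoeff ℂ p.1‖ = expSqCoeff ℝ p.1 := by
    unfold expSqCoeff
    split_ifs <;> simp
  have hb0 : 0 ≤ expSqCoeff ℝ p.1 := hb ▸ norm_nonneg _
  rw [norm_mul, norm_div, norm_pow, hb, Complex.norm_natCast]
  gcongr

/-- The left side is the top-degree term. The bound lets Taylor series share the majorant of the
heat expansion. -/
theorem norm_pow_div_factorial_le_heatPoly (n : ℕ) (w : ℂ) :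
    ‖w ^ n / (n.factorial : ℂ)‖ ≤ heatPoly n ‖w‖ := by
  have h0 : ∀ i, 0 ≤ expSqCoeff ℝ i := fun i => by
    unfold expSqCoeff
    split_ifs <;> positivity
  have h := Finset.single_le_sum
    (f := fun p : ℕ × ℕ => expSqCoeff ℝ p.1 * (‖w‖ ^ p.2 / (p.2.factorial : ℝ)))
    (s := Finset.HasAntidiagonal.antidiagonal n) (fun p _ => mul_nonneg (h0 _) (by positivity))
    (a := (0, n)) (by simp)
  simpa [heatPoly, expSqCoeff] using h

theorem heatPoly_eq_sum_range (n : ℕ) (v : ℂ) :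
    heatPoly n v = ∑ j ∈ Finset.range (n / 2 + 1),
      ((j.factorial : ℂ) * ((n - 2 * j).factorial : ℂ))⁻¹ * v ^ (n - 2 * j) := by
  symm
  refine Finset.sum_of_injOn (fun j => (2 * j, n - 2 * j)) ?_ ?_ ?_ ?_
  · intro a _ b _ hab
    simp only [Prod.mk.injEq] at hab
    omega
  · intro j hj
    simp only [Finset.coe_range, Set.mem_Iio] at hj
    simp only [Finset.mem_coe, Finset.HasAntidiagonal.mem_antidiagonal]
    omega
  · rintro ⟨a, b⟩ hab hn
    rw [Finset.HasAntidiagonal.mem_antidiagonal] at hab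
    have : ¬ Even a := by
      rintro ⟨k, hk⟩
      refine hn ⟨k, ?_, ?_⟩
      · simp only [Finset.coe_range, Set.mem_Iio]
        omega
      · simp only [Prod.mk.injEq]
        omega
    simp [expSqCoeff, this]
  · intro j _
    simp [expSqCoeff, div_eq_mul_inv]
    ring

/-- A heat polynomial of degree at least two has a root that is not real. -/
theorem exists_heatPoly_eq_zero {n : ℕ} (hn : 2 ≤ n) : ∃ v : ℂ, heatPoly n v = 0 ∧ v.im ≠ 0 := by
  set c : ℕ → ℝ := fun j => ((j.factorial : ℝ) * ((n - 2 * j).factorial : ℝ))⁻¹ with hc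
  have hcpos : ∀ j, 0 < c j := fun j => by positivity
  -- All exponents of `v` have the parity of `n`, so `heatPoly n v = v ^ (n % 2) * Q (v²)`, where
  -- `Q` has positive coefficients and degree `n / 2 ≥ 1`.
  set Q : Polynomial ℂ := ∑ j ∈ Finset.range (n / 2 + 1),
    Polynomial.C (c j : ℂ) * Polynomial.X ^ (n / 2 - j) with hQ
  have hcoeff : Q.coeff (n / 2) ≠ 0 := by
    rw [hQ, Polynomial.finsetSum_coeff, Finset.sum_eq_single 0]
    · simpa using (hcpos 0).ne'
    · intro j hj hj0
      rw [Finset.mem_range] at hj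
      rw [Polynomial.coeff_C_mul_X_pow, if_neg (by omega)]
    · simp
  have hdeg : 0 < Q.degree := by
    refine lt_of_lt_of_le ?_ (Polynomial.le_degree_of_ne_zero hcoeff)
    exact_mod_cast (by omega : 0 < n / 2)
  obtain ⟨q, hq⟩ := Complex.exists_root hdeg
  have hev : ∀ y : ℂ, Q.eval y = ∑ j ∈ Finset.range (n / 2 + 1), (c j : ℂ) * y ^ (n / 2 - j) := by
    intro y
    simp [hQ, Polynomial.eval_finsetSum]
  obtain ⟨v, rfl⟩ : ∃ v : ℂ, v ^ 2 = q := IsAlgClosed.exists_pow_nat_eq q two_pos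
  refine ⟨v, ?_, fun him => ?_⟩
  · have : heatPoly n v = v ^ (n % 2) * Q.eval (v ^ 2) := by
      rw [heatPoly_eq_sum_range, hev, Finset.mul_sum]
      refine Finset.sum_congr rfl fun j hj => ?_
      rw [Finset.mem_range] at hj
      have e : n - 2 * j = n % 2 + 2 * (n / 2 - j) := by omega
      have e' : v ^ (n - 2 * j) = v ^ (n % 2) * (v ^ 2) ^ (n / 2 - j) := by
        rw [← pow_mul, ← pow_add, ← e]
      rw [e']
      simp only [hc]
      push_cast
      ring
    rw [this, hq.eq_zero, mul_zero]
  · have hv : v = (v.re : ℂ) := Complex.ext (by simp) (by simp [him])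
    have h0 := hq.eq_zero
    rw [hev, hv] at h0
    have h1 : ∑ j ∈ Finset.range (n / 2 + 1), c j * (v.re ^ 2) ^ (n / 2 - j) = 0 := by
      exact_mod_cast h0
    -- For real `v` all terms are nonnegative, while the constant term `j = n / 2` is positive.
    have h2 := Finset.single_le_sum (f := fun j => c j * (v.re ^ 2) ^ (n / 2 - j))
      (s := Finset.range (n / 2 + 1))
      (fun j _ => mul_nonneg (hcpos j).le (by positivity)) (a := n / 2) (by simp)
    rw [h1] at h2
    simp only [Nat.sub_self, pow_zero, mul_one] at h2
    exact absurd h2 (not_le.2 (hcpos _))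

/-! ### Continuity and decay of `Φ`. -/

theorem abs_kroneckerSymbol_le_one (a : ℤ) (n : ℕ) : |(kroneckerSymbol a n : ℝ)| ≤ 1 := by
  have h8 : ∀ x : ZMod 8, |ZMod.χ₈ x| ≤ 1 := by decide
  have hj : ∀ m : ℕ, |jacobiSym a m| ≤ 1 := fun m => by
    rcases jacobiSym.trichotomy a m with h | h | h <;> simp [h]
  have : |kroneckerSymbol a n| ≤ 1 := by
    unfold kroneckerSymbol
    split_ifs
    · simp
    · simp
    · rw [abs_mul, abs_pow]
      exact mul_le_one₀ (pow_le_one₀ (abs_nonneg _) (h8 _)) (abs_nonneg _) (hj _)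
  exact_mod_cast this

theorem abs_Phi_term_le {D : ℕ} (hD : 0 < D) (n : ℕ) {u : ℝ} (hu : 0 ≤ u) :
    |(kroneckerSymbol (-(D : ℤ)) n : ℝ) * (n : ℝ) *
      Real.exp (3 * u / 2 - (n : ℝ) ^ 2 * Real.pi * Real.exp (2 * u) / (D : ℝ))| ≤
    (n : ℝ) * Real.exp (-(Real.pi / (2 * D)) * n) *
      Real.exp (3 * u / 2 - Real.pi / (2 * D) * Real.exp (2 * u)) := by
  have hD' : (0 : ℝ) < D := by exact_mod_cast hD
  rcases Nat.eq_zero_or_pos n with rfl | hn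
  · simp
  have hn1 : (1 : ℝ) ≤ n := by exact_mod_cast hn
  have he : 1 ≤ Real.exp (2 * u) := Real.one_le_exp (by linarith)
  rw [abs_mul, abs_mul, Real.abs_exp, Nat.abs_cast, mul_assoc (n : ℝ), ← Real.exp_add, mul_assoc]
  refine (mul_le_of_le_one_left (by positivity) (abs_kroneckerSymbol_le_one _ _)).trans ?_
  refine mul_le_mul_of_nonneg_left (Real.exp_le_exp.2 ?_) (by positivity)
  -- Both summands are at most `n² exp (2u)`; this separates the variables `n` and `u`.
  have key : (n : ℝ) + Real.exp (2 * u) ≤ 2 * ((n : ℝ) ^ 2 * Real.exp (2 * u)) := by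
    nlinarith [mul_nonneg (sub_nonneg.2 hn1) (sub_nonneg.2 he), mul_self_nonneg ((n : ℝ) - 1),
      mul_nonneg (mul_self_nonneg ((n : ℝ) - 1)) (sub_nonneg.2 he)]
  have := mul_le_mul_of_nonneg_left key (by positivity : 0 ≤ Real.pi / (2 * D))
  have e : Real.pi / (2 * D) * (2 * ((n : ℝ) ^ 2 * Real.exp (2 * u))) =
      (n : ℝ) ^ 2 * Real.pi * Real.exp (2 * u) / (D : ℝ) := by
    field_simp
  rw [e] at this
  linarith

theorem summable_nat_mul_exp_neg {c : ℝ} (hc : 0 < c) :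
    Summable fun n : ℕ => (n : ℝ) * Real.exp (-c * n) := by
  simpa using Real.summable_pow_mul_exp_neg_nat_mul 1 hc

theorem abs_Phi_le {D : ℕ} (hD : 0 < D) {u : ℝ} (hu : 0 ≤ u) :
    |Phi D u| ≤ 4 * (∑' n : ℕ, (n : ℝ) * Real.exp (-(Real.pi / (2 * D)) * n)) *
      Real.exp (3 * u / 2 - Real.pi / (2 * D) * Real.exp (2 * u)) := by
  have hD' : (0 : ℝ) < D := by exact_mod_cast hD
  have hs := summable_nat_mul_exp_neg (c := Real.pi / (2 * D)) (by positivity)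
  rw [Phi, abs_mul, abs_of_pos (by norm_num : (0 : ℝ) < 4), mul_assoc, ← tsum_mul_right]
  refine mul_le_mul_of_nonneg_left ?_ (by norm_num)
  exact tsum_of_norm_bounded (f := fun n : ℕ => (kroneckerSymbol (-(D : ℤ)) n : ℝ) * (n : ℝ) *
    Real.exp (3 * u / 2 - (n : ℝ) ^ 2 * Real.pi * Real.exp (2 * u) / (D : ℝ)))
    (hs.mul_right _).hasSum fun n => abs_Phi_term_le hD n hu

theorem continuousOn_Phi {D : ℕ} (hD : 0 < D) : ContinuousOn (Phi D) (Set.Ici 0) := by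
  have hD' : (0 : ℝ) < D := by exact_mod_cast hD
  have hc : 0 < Real.pi / (2 * D) := by positivity
  set c := Real.pi / (2 * D)
  refine continuousOn_const.mul (continuousOn_tsum
    (u := fun n : ℕ => (n : ℝ) * Real.exp (-c * n) * c⁻¹) (fun n => by fun_prop)
    ((summable_nat_mul_exp_neg hc).mul_right _) fun n u hu => ?_)
  refine (abs_Phi_term_le hD n hu).trans (mul_le_mul_of_nonneg_left ?_ (by positivity))
  have hu : 0 ≤ u := hu
  have h₁ : Real.exp (3 * u / 2) ≤ Real.exp (2 * u) := Real.exp_le_exp.2 (by linarith)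
  have h₂ : c * Real.exp (2 * u) ≤ Real.exp (c * Real.exp (2 * u)) := by
    linarith [Real.add_one_le_exp (c * Real.exp (2 * u))]
  rw [Real.exp_sub, div_le_iff₀ (Real.exp_pos _)]
  calc Real.exp (3 * u / 2) ≤ c⁻¹ * (c * Real.exp (2 * u)) := by
        rwa [inv_mul_cancel_left₀ hc.ne']
    _ ≤ _ := by gcongr

/-- The `5/2` is the `3/2` in the exponent of `Φ` plus `1` for the decay rate `exp (-u)` used for
integrability. -/
theorem eventually_quadratic_le_exp (a : ℝ) {c : ℝ} (hc : 0 < c) :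
    ∀ᶠ u : ℝ in Filter.atTop, a * u ^ 2 + 5 / 2 * u ≤ c * Real.exp (2 * u) := by
  have h := (Real.isLittleO_pow_exp_atTop (n := 2)).bound
    (show 0 < c / (|a| + 5 / 2) by positivity)
  filter_upwards [h, Filter.eventually_ge_atTop 1] with u hu h1
  rw [Real.norm_of_nonneg (by positivity), Real.norm_of_nonneg (Real.exp_pos u).le,
    div_mul_eq_mul_div, le_div_iff₀ (by positivity)] at hu
  have h2 : c * Real.exp u ≤ c * Real.exp (2 * u) := by
    gcongr
    linarith
  nlinarith [mul_le_mul_of_nonneg_right (le_abs_self a) (sq_nonneg u)]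

/-- `Φ` decays faster than every Gaussian. -/
theorem integrableOn_exp_mul_sq_mul_Phi {D : ℕ} (hD : 0 < D) (a : ℝ) :
    IntegrableOn (fun u => Real.exp (a * u ^ 2) * Phi D u) (Set.Ioi 0) := by
  have hD' : (0 : ℝ) < D := by exact_mod_cast hD
  have hc : 0 < Real.pi / (2 * D) := by positivity
  refine integrable_of_isBigO_exp_neg one_pos
    (ContinuousOn.mul (by fun_prop) (continuousOn_Phi hD)) ?_
  refine Asymptotics.IsBigO.of_bound
    (4 * ∑' n : ℕ, (n : ℝ) * Real.exp (-(Real.pi / (2 * D)) * n)) ?_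
  filter_upwards [eventually_quadratic_le_exp a hc, Filter.eventually_ge_atTop 0] with u hu h0
  have hS : 0 ≤ ∑' n : ℕ, (n : ℝ) * Real.exp (-(Real.pi / (2 * D)) * n) :=
    tsum_nonneg fun n => by positivity
  rw [norm_mul, Real.norm_eq_abs, Real.abs_exp, Real.norm_eq_abs, Real.norm_eq_abs, Real.abs_exp]
  refine (mul_le_mul_of_nonneg_left (abs_Phi_le hD h0) (Real.exp_pos _).le).trans ?_
  rw [mul_left_comm, ← Real.exp_add]
  gcongr
  linarith

/-! ### Cosine transforms and their expansions. -/

/-- The `k`-th derivative of the complex cosine. -/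
def cosDeriv (k : ℕ) (θ : ℂ) : ℂ :=
  (Complex.I ^ k * Complex.exp (Complex.I * θ) +
    (-Complex.I) ^ k * Complex.exp (-Complex.I * θ)) / 2

theorem norm_cosDeriv_le (k : ℕ) (θ : ℂ) : ‖cosDeriv k θ‖ ≤ Real.exp ‖θ‖ := by
  have h₁ := Complex.norm_exp_le_exp_norm (Complex.I * θ)
  have h₂ := Complex.norm_exp_le_exp_norm (-Complex.I * θ)
  have h₃ := norm_add_le (Complex.I ^ k * Complex.exp (Complex.I * θ))
    ((-Complex.I) ^ k * Complex.exp (-Complex.I * θ))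
  simp only [norm_mul, norm_pow, norm_neg, Complex.norm_I, one_pow, one_mul] at h₁ h₂ h₃
  rw [cosDeriv, norm_div, Complex.norm_ofNat]
  linarith

@[fun_prop]
theorem continuous_cosDeriv (k : ℕ) : Continuous (cosDeriv k) := by
  unfold cosDeriv
  fun_prop

theorem hasSum_cos_add (θ w : ℂ) (u : ℂ) :
    HasSum (fun k => w ^ k / (k.factorial : ℂ) * (u ^ k * cosDeriv k θ))
      (Complex.cos (θ + u * w)) := by
  have h₁ := (NormedSpace.expSeries_div_hasSum_exp (Complex.I * (u * w))).mul_right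
    (Complex.exp (Complex.I * θ))
  have h₂ := (NormedSpace.expSeries_div_hasSum_exp (-Complex.I * (u * w))).mul_right
    (Complex.exp (-Complex.I * θ))
  rw [← Complex.exp_eq_exp_ℂ, ← Complex.exp_add] at h₁ h₂
  have e : Complex.cos (θ + u * w) = (Complex.exp (Complex.I * (u * w) + Complex.I * θ) +
      Complex.exp (-Complex.I * (u * w) + -Complex.I * θ)) / 2 := by
    unfold Complex.cos
    ring_nf
  rw [e]
  refine ((h₁.add h₂).div_const 2).congr_fun fun k => ?_
  rw [cosDeriv, mul_pow, mul_pow, mul_pow]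
  ring

theorem hasSum_exp_neg_sq_mul_cos_add (θ v s u : ℂ) :
    HasSum (fun k => s ^ k * heatPoly k v * (u ^ k * cosDeriv k θ))
      (Complex.exp (-(s * u) ^ 2) * Complex.cos (θ + u * (s * v))) := by
  have h₁ := (hasSum_heatPoly v (Complex.I * (s * u))).mul_right (Complex.exp (Complex.I * θ))
  have h₂ := (hasSum_heatPoly v (-Complex.I * (s * u))).mul_right (Complex.exp (-Complex.I * θ))
  rw [← Complex.exp_eq_exp_ℂ, ← Complex.exp_add] at h₁ h₂
  have e : Complex.exp (-(s * u) ^ 2) * Complex.cos (θ + u * (s * v)) =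
      (Complex.exp ((Complex.I * (s * u)) ^ 2 + Complex.I * (s * u) * v + Complex.I * θ) +
        Complex.exp ((-Complex.I * (s * u)) ^ 2 + -Complex.I * (s * u) * v +
          -Complex.I * θ)) / 2 := by
    unfold Complex.cos
    rw [mul_div_assoc', mul_add, ← Complex.exp_add, ← Complex.exp_add, mul_pow Complex.I,
      mul_pow (-Complex.I), neg_sq, Complex.I_sq]
    ring_nf
  rw [e]
  refine ((h₁.add h₂).div_const 2).congr_fun fun k => ?_
  rw [cosDeriv, mul_pow, mul_pow, mul_pow]
  ring

/-- The cosine transform of `Ψ` with respect to `μ`. -/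
def cosTransform (μ : Measure ℝ) (Ψ : ℝ → ℝ) (z : ℂ) : ℂ :=
  ∫ u, (Ψ u : ℂ) * Complex.cos (u * z) ∂μ

/-- The `k`-th derivative of the cosine transform of `Ψ`, as an integral. -/
def cosMoment (μ : Measure ℝ) (Ψ : ℝ → ℝ) (z : ℂ) (k : ℕ) : ℂ :=
  ∫ u, (Ψ u : ℂ) * ((u : ℂ) ^ k * cosDeriv k (u * z)) ∂μ

variable {μ : Measure ℝ} {Ψ : ℝ → ℝ}

/-- Dominated convergence: the majorants `heatPoly k R * |u| ^ k` sum to `exp (u² + |u| R)`. The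
coefficients stay general to cover both the Taylor and the heat expansion. -/
theorem hasSum_mul_cosMoment (hΨ : ∀ a : ℝ, Integrable (fun u => Real.exp (a * u ^ 2) * Ψ u) μ)
    {z : ℂ} {c : ℕ → ℂ} {R : ℝ} (hc : ∀ k, ‖c k‖ ≤ heatPoly k R) {F : ℝ → ℂ}
    (hF : ∀ u : ℝ, HasSum (fun k => c k * ((u : ℂ) ^ k * cosDeriv k (u * z))) (F u)) :
    HasSum (fun k => c k * cosMoment μ Ψ z k) (∫ u, (Ψ u : ℂ) * F u ∂μ) := by
  have hm : AEStronglyMeasurable Ψ μ := by simpa using (hΨ 0).aestronglyMeasurable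
  have hs : ∀ u : ℝ, HasSum (fun k => |Ψ u| * Real.exp (|u| * ‖z‖) * (heatPoly k R * |u| ^ k))
      (|Ψ u| * Real.exp (|u| * ‖z‖) * Real.exp (|u| ^ 2 + |u| * R)) := fun u => by
    have := hasSum_heatPoly R |u|
    rw [← Real.exp_eq_exp_ℝ] at this
    exact this.mul_left _
  simp_rw [cosMoment, ← integral_const_mul]
  refine hasSum_integral_of_dominated_convergence
    (fun k u => |Ψ u| * Real.exp (|u| * ‖z‖) * (heatPoly k R * |u| ^ k)) (fun k => ?_)
    (fun k => .of_forall fun u => ?_) (.of_forall fun u => (hs u).summable) ?_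
    (.of_forall fun u => ?_)
  · refine AEStronglyMeasurable.const_mul (AEStronglyMeasurable.mul
      (Complex.continuous_ofReal.comp_aestronglyMeasurable hm) ?_) _
    exact Continuous.aestronglyMeasurable (by fun_prop)
  · have h := norm_cosDeriv_le k (u * z)
    rw [norm_mul, Complex.norm_real, Real.norm_eq_abs] at h
    have h0 : 0 ≤ heatPoly k R := (norm_nonneg _).trans (hc k)
    simp only [norm_mul, norm_pow, Complex.norm_real, Real.norm_eq_abs]
    calc ‖c k‖ * (|Ψ u| * (|u| ^ k * ‖cosDeriv k (u * z)‖))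
        ≤ heatPoly k R * (|Ψ u| * (|u| ^ k * Real.exp (|u| * ‖z‖))) := by
          gcongr
          exact hc k
      _ = _ := by ring
  · simp_rw [(hs _).tsum_eq]
    -- The exponent satisfies `u² + |u| (‖z‖ + R) ≤ 2 u² + (‖z‖ + R)²`.
    refine ((hΨ 2).norm.const_mul (Real.exp ((‖z‖ + R) ^ 2))).mono' ?_ (.of_forall fun u => ?_)
    · exact (hm.norm.mul (Continuous.aestronglyMeasurable (by fun_prop))).mul
        (Continuous.aestronglyMeasurable (by fun_prop))
    · simp only [norm_mul, Real.norm_eq_abs, abs_abs, Real.abs_exp]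
      rw [mul_assoc, mul_comm |Ψ u|, ← mul_assoc, ← Real.exp_add, ← Real.exp_add]
      refine mul_le_mul_of_nonneg_right (Real.exp_le_exp.2 ?_) (abs_nonneg _)
      rw [← sq_abs u]
      nlinarith [sq_nonneg (|u| - (‖z‖ + R)), sq_nonneg (|u|), sq_nonneg (‖z‖ + R)]
  · exact ((hF u).mul_left (Ψ u : ℂ)).congr_fun fun k => by ring

theorem hasSum_cosTransform (hΨ : ∀ a : ℝ, Integrable (fun u => Real.exp (a * u ^ 2) * Ψ u) μ)
    (z w : ℂ) :
    HasSum (fun k => w ^ k / (k.factorial : ℂ) * cosMoment μ Ψ z k)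
      (cosTransform μ Ψ (z + w)) := by
  simp_rw [cosTransform, mul_add]
  exact hasSum_mul_cosMoment hΨ (norm_pow_div_factorial_le_heatPoly · w)
    fun u => hasSum_cos_add _ _ _

/-- The cosine transforms of `exp (-s² u²) Ψ(u)` near `z`, rescaled by `s`, in terms of the
derivatives at `z` of the cosine transform of `Ψ`. -/
theorem hasSum_cosTransform_exp_neg_sq
    (hΨ : ∀ a : ℝ, Integrable (fun u => Real.exp (a * u ^ 2) * Ψ u) μ)
    (z v : ℂ) {s : ℝ} (hs₀ : 0 ≤ s) (hs : s ≤ 1) :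
    HasSum (fun k => (s : ℂ) ^ k * heatPoly k v * cosMoment μ Ψ z k)
      (cosTransform μ (fun u => Real.exp (-s ^ 2 * u ^ 2) * Ψ u) (z + s * v)) := by
  have hc : ∀ k, ‖(s : ℂ) ^ k * heatPoly k v‖ ≤ heatPoly k ‖v‖ := fun k => by
    rw [norm_mul, norm_pow, Complex.norm_real, Real.norm_of_nonneg hs₀]
    exact (mul_le_of_le_one_left (norm_nonneg _) (pow_le_one₀ hs₀ hs)).trans
      (norm_heatPoly_le le_rfl)
  convert hasSum_mul_cosMoment hΨ hc
    (fun u => hasSum_exp_neg_sq_mul_cos_add (u * z) v s u) using 1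
  rw [cosTransform]
  congr 1
  funext u
  push_cast
  ring_nf

theorem hasFPowerSeriesAt_cosTransform
    (hΨ : ∀ a : ℝ, Integrable (fun u => Real.exp (a * u ^ 2) * Ψ u) μ) (z : ℂ) :
    HasFPowerSeriesAt (cosTransform μ Ψ)
      (FormalMultilinearSeries.ofScalars ℂ fun k => (k.factorial : ℂ)⁻¹ * cosMoment μ Ψ z k) z := by
  refine hasFPowerSeriesAt_iff.2 (.of_forall fun w => ?_)
  refine (hasSum_cosTransform hΨ z w).congr_fun fun k => ?_
  rw [FormalMultilinearSeries.coeff_ofScalars, smul_eq_mul]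
  ring

theorem differentiable_cosTransform
    (hΨ : ∀ a : ℝ, Integrable (fun u => Real.exp (a * u ^ 2) * Ψ u) μ) :
    Differentiable ℂ (cosTransform μ Ψ) := fun z =>
  (hasFPowerSeriesAt_cosTransform hΨ z).analyticAt.differentiableAt

theorem cosMoment_zero (z : ℂ) : cosMoment μ Ψ z 0 = cosTransform μ Ψ z := by
  simp [cosMoment, cosTransform, cosDeriv, Complex.cos, mul_comm]

theorem deriv_cosTransform (hΨ : ∀ a : ℝ, Integrable (fun u => Real.exp (a * u ^ 2) * Ψ u) μ)
    (z : ℂ) : deriv (cosTransform μ Ψ) z = cosMoment μ Ψ z 1 := by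
  rw [(hasFPowerSeriesAt_cosTransform hΨ z).deriv]
  simp [FormalMultilinearSeries.ofScalars]

theorem ofReal_heatPoly (n : ℕ) (r : ℝ) : ((heatPoly n r : ℝ) : ℂ) = heatPoly n (r : ℂ) := by
  simp only [heatPoly, expSqCoeff]
  push_cast
  refine Finset.sum_congr rfl fun p _ => ?_
  split_ifs <;> simp

@[fun_prop]
theorem differentiable_heatPoly (n : ℕ) : Differentiable ℂ (heatPoly n : ℂ → ℂ) := by
  unfold heatPoly
  fun_prop

/-! ### Splitting of multiple zeros. -/

/-- A weak form of Hurwitz's theorem: a function uniformly close to `g` on a closed disc vanishes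
somewhere in the disc, provided that `g` vanishes at the centre and is bounded below on the
boundary circle. -/
theorem exists_eq_zero_of_norm_sub_le {f g : ℂ → ℂ} {z₀ : ℂ} {r δ η : ℝ}
    (hf : Differentiable ℂ f) (hr : 0 < r) (hg₀ : g z₀ = 0)
    (hg : ∀ z ∈ Metric.sphere z₀ r, δ ≤ ‖g z‖)
    (hfg : ∀ z ∈ Metric.closedBall z₀ r, ‖f z - g z‖ ≤ η) (hη : 4 * η < δ) :
    ∃ z ∈ Metric.closedBall z₀ r, f z = 0 := by
  have h₀ : ‖f z₀‖ ≤ η := by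
    simpa [hg₀] using hfg z₀ (Metric.mem_closedBall_self hr.le)
  have hη₀ : 0 ≤ η := (norm_nonneg _).trans h₀
  have hlow : ∀ z ∈ Metric.sphere z₀ r, δ - 2 * η ≤ ‖f z - f z₀‖ := by
    intro z hz
    have h₁ := hfg z (Metric.sphere_subset_closedBall hz)
    have h₂ := hg z hz
    have h₃ := norm_sub_le (f z - f z₀) (f z - g z - f z₀)
    have h₄ := norm_sub_le (f z - g z) (f z₀)
    rw [show f z - f z₀ - (f z - g z - f z₀) = g z by ring] at h₃
    linarith
  have hfreq : ∃ᶠ z in nhds z₀, f z ≠ f z₀ := by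
    intro hev
    have hev' : f =ᶠ[nhds z₀] fun _ => f z₀ := hev.mono fun z hz => not_not.1 hz
    have hc := AnalyticOnNhd.eqOn_of_preconnected_of_eventuallyEq
      (hf.differentiableOn.analyticOnNhd isOpen_univ) analyticOnNhd_const isPreconnected_univ
      (Set.mem_univ z₀) hev'
    have hz : z₀ + (r : ℂ) ∈ Metric.sphere z₀ r := by simp [abs_of_pos hr]
    have := hlow _ hz
    rw [hc (Set.mem_univ _), sub_self, norm_zero] at this
    linarith
  -- Quantitative open mapping: the image contains the ball of radius `(δ - 2η) / 2` about `f z₀`.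
  -- Since `‖f z₀‖ ≤ η`, it contains `0` once `4η < δ`.
  have hsub := hf.diffContOnCl.ball_subset_image_closedBall hr hlow hfreq
  have h0 : (0 : ℂ) ∈ Metric.ball (f z₀) ((δ - 2 * η) / 2) := by
    rw [Metric.mem_ball, dist_comm, dist_zero_right]
    linarith
  exact hsub h0

/-- This is absolute convergence of the heat expansion at `s = 1`, `v = R`; the sum serves as an
error constant independent of `s`. -/
theorem summable_heatPoly_mul_norm_cosMoment
    (hΨ : ∀ a : ℝ, Integrable (fun u => Real.exp (a * u ^ 2) * Ψ u) μ) (z : ℂ) {R : ℝ}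
    (hR : 0 ≤ R) : Summable fun k => heatPoly k R * ‖cosMoment μ Ψ z k‖ := by
  have h := (hasSum_cosTransform_exp_neg_sq hΨ z R zero_le_one le_rfl).summable.norm
  refine h.congr fun k => ?_
  have h0 : 0 ≤ heatPoly k R :=
    (norm_nonneg _).trans (norm_heatPoly_le (v := (R : ℂ)) (by simp [abs_of_nonneg hR]))
  rw [← ofReal_heatPoly, norm_mul, norm_mul, Complex.norm_real, Real.norm_of_nonneg h0]
  simp

/-- The leading term of the cosine transforms of `exp (-s² u²) Ψ(u)` near a zero of order `m` of
the cosine transform of `Ψ`. -/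
theorem norm_cosTransform_exp_neg_sq_sub_le
    (hΨ : ∀ a : ℝ, Integrable (fun u => Real.exp (a * u ^ 2) * Ψ u) μ) {z v : ℂ} {m : ℕ}
    (hm : ∀ k < m, cosMoment μ Ψ z k = 0) {s R : ℝ} (hs₀ : 0 ≤ s) (hs : s ≤ 1) (hv : ‖v‖ ≤ R) :
    ‖cosTransform μ (fun u => Real.exp (-s ^ 2 * u ^ 2) * Ψ u) (z + s * v) -
      (s : ℂ) ^ m * heatPoly m v * cosMoment μ Ψ z m‖ ≤
    s ^ (m + 1) * ∑' k, heatPoly k R * ‖cosMoment μ Ψ z k‖ := by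
  have hS := summable_heatPoly_mul_norm_cosMoment hΨ z ((norm_nonneg v).trans hv)
  have h := (hasSum_cosTransform_exp_neg_sq hΨ z v hs₀ hs).sub
    (hasSum_ite_eq m ((s : ℂ) ^ m * heatPoly m v * cosMoment μ Ψ z m))
  rw [← h.tsum_eq]
  refine tsum_of_norm_bounded (hS.hasSum.mul_left _) fun k => ?_
  have h0 : 0 ≤ heatPoly k R := (norm_nonneg _).trans (norm_heatPoly_le hv)
  rcases lt_trichotomy k m with hk | rfl | hk
  · simp [hm k hk, hk.ne]
  · simp only [if_true, sub_self, norm_zero]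
    positivity
  · rw [if_neg hk.ne', sub_zero, norm_mul, norm_mul, norm_pow, Complex.norm_real,
      Real.norm_of_nonneg hs₀, mul_assoc]
    have h₁ := pow_le_pow_of_le_one hs₀ hs (Nat.succ_le_of_lt hk)
    have h₂ := norm_heatPoly_le (n := k) hv
    gcongr

/-- A multiple real zero of the cosine transform of `Ψ` splits into zeros of which some are not
real when `Ψ` is multiplied by `exp (-s² u²)`. -/
theorem eventually_exists_nonreal_zero
    (hΨ : ∀ a : ℝ, Integrable (fun u => Real.exp (a * u ^ 2) * Ψ u) μ)
    (hne : ∃ z, cosTransform μ Ψ z ≠ 0) {x : ℝ} (h₀ : cosTransform μ Ψ x = 0)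
    (h₁ : deriv (cosTransform μ Ψ) x = 0) :
    ∀ᶠ s : ℝ in nhdsWithin 0 (Set.Ioi 0), ∃ z : ℂ, z.im ≠ 0 ∧
      cosTransform μ (fun u => Real.exp (-s ^ 2 * u ^ 2) * Ψ u) z = 0 := by
  have hex : ∃ k, cosMoment μ Ψ x k ≠ 0 := by
    by_contra! hall
    obtain ⟨z, hz⟩ := hne
    have h := hasSum_cosTransform hΨ x (z - x)
    simp only [hall, mul_zero, add_sub_cancel] at h
    exact hz (h.unique hasSum_zero)
  classical
  set m := Nat.find hex
  have hA : cosMoment μ Ψ x m ≠ 0 := Nat.find_spec hex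
  have hlt : ∀ k < m, cosMoment μ Ψ x k = 0 := fun k hk => not_not.1 (Nat.find_min hex hk)
  rw [deriv_cosTransform hΨ] at h₁
  rw [← cosMoment_zero] at h₀
  have hm2 : 2 ≤ m := by
    by_contra! hcon
    interval_cases m
    · exact hA h₀
    · exact hA h₁
  obtain ⟨v₀, hv₀, him⟩ := exists_heatPoly_eq_zero hm2
  set g : ℂ → ℂ := fun v => heatPoly m v * cosMoment μ Ψ x m with hg
  have hgd : Differentiable ℂ g := by fun_prop
  -- isolate the zero `v₀` of `g` in a disc off the real line
  have hgne : ∀ᶠ v in nhdsWithin v₀ {v₀}ᶜ, g v ≠ 0 := by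
    refine (hgd.analyticAt v₀).eventually_eq_zero_or_eventually_ne_zero.resolve_left fun hev => ?_
    have hc := AnalyticOnNhd.eqOn_of_preconnected_of_eventuallyEq
      (hgd.differentiableOn.analyticOnNhd isOpen_univ) analyticOnNhd_const isPreconnected_univ
      (Set.mem_univ v₀) (show g =ᶠ[nhds v₀] fun _ => 0 from hev)
    -- The heat polynomial is positive at `1`, so `g` is not identically zero.
    have h1 := hc (Set.mem_univ 1)
    simp only [hg, mul_eq_zero, hA, or_false] at h1
    have h2 := norm_pow_div_factorial_le_heatPoly m 1
    rw [← Complex.ofReal_one, ← ofReal_heatPoly, Complex.ofReal_eq_zero] at h1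
    rw [norm_one, h1] at h2
    have h3 := norm_le_zero_iff.1 h2
    simp [Nat.factorial_ne_zero] at h3
  have himne : ∀ᶠ v in nhds v₀, v.im ≠ 0 :=
    Complex.continuous_im.continuousAt.eventually_ne him
  obtain ⟨ρ, hρ, hball⟩ := Metric.eventually_nhds_iff.1
    (himne.and (eventually_nhdsWithin_iff.1 hgne))
  set r := ρ / 2
  have hr : 0 < r := by positivity
  have hrρ : r < ρ := half_lt_self hρ
  obtain ⟨w, hw, hmin⟩ := (isCompact_sphere v₀ r).exists_isMinOn
    (NormedSpace.sphere_nonempty.2 hr.le) hgd.continuous.norm.continuousOn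
  have hδ : 0 < ‖g w‖ := by
    refine norm_pos_iff.2 ((hball ((Metric.mem_sphere.1 hw).trans_lt hrρ)).2 ?_)
    rintro rfl
    simp [hr.ne] at hw
  set R := ‖v₀‖ + r
  set S := ∑' k, heatPoly k R * ‖cosMoment μ Ψ x k‖
  have hlim : ∀ᶠ s : ℝ in nhdsWithin 0 (Set.Ioi 0), 4 * (s * S) < ‖g w‖ := by
    refine nhdsWithin_le_nhds (Filter.Tendsto.eventually_lt_const (v := 0) hδ ?_)
    exact Continuous.tendsto' (by fun_prop) _ _ (by simp)
  filter_upwards [hlim, Ioc_mem_nhdsGT (zero_lt_one' ℝ)] with s hs ⟨hs0, hs1⟩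
  have hs0' : (s : ℂ) ≠ 0 := by exact_mod_cast hs0.ne'
  have hΨs : ∀ a : ℝ, Integrable
      (fun u => Real.exp (a * u ^ 2) * (Real.exp (-s ^ 2 * u ^ 2) * Ψ u)) μ := fun a => by
    refine (hΨ (a - s ^ 2)).congr (.of_forall fun u => ?_)
    simp only
    rw [← mul_assoc, ← Real.exp_add]
    ring_nf
  have hd := differentiable_cosTransform hΨs
  have hclose : ∀ v ∈ Metric.closedBall v₀ r, ‖((s : ℂ) ^ m)⁻¹ *
      cosTransform μ (fun u => Real.exp (-s ^ 2 * u ^ 2) * Ψ u) (x + s * v) - g v‖ ≤ s * S := by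
    intro v hv
    have hvR : ‖v‖ ≤ R := by
      have := norm_le_norm_add_norm_sub' v v₀
      rw [Metric.mem_closedBall, dist_eq_norm] at hv
      simp only [R]
      linarith
    have h := norm_cosTransform_exp_neg_sq_sub_le hΨ hlt hs0.le hs1 hvR
    have e : ((s : ℂ) ^ m)⁻¹ *
        cosTransform μ (fun u => Real.exp (-s ^ 2 * u ^ 2) * Ψ u) (x + s * v) - g v =
        ((s : ℂ) ^ m)⁻¹ * (cosTransform μ (fun u => Real.exp (-s ^ 2 * u ^ 2) * Ψ u) (x + s * v) -
          (s : ℂ) ^ m * heatPoly m v * cosMoment μ Ψ x m) := by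
      simp only [hg]
      field_simp
    rw [e, norm_mul, norm_inv, norm_pow, Complex.norm_real, Real.norm_of_nonneg hs0.le,
      inv_mul_le_iff₀ (by positivity), ← mul_assoc, ← pow_succ]
    exact h
  obtain ⟨v, hv, hzero⟩ := exists_eq_zero_of_norm_sub_le
    (f := fun v => ((s : ℂ) ^ m)⁻¹ *
      cosTransform μ (fun u => Real.exp (-s ^ 2 * u ^ 2) * Ψ u) (x + s * v))
    (g := g) (z₀ := v₀) (r := r) (δ := ‖g w‖) (η := s * S)
    ((hd.comp (by fun_prop : Differentiable ℂ fun v : ℂ => (x : ℂ) + s * v)).const_mul _) hr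
    (by simp [hg, hv₀]) (fun z hz => hmin hz) hclose hs
  refine ⟨x + s * v, ?_, ?_⟩
  · have := (hball ((Metric.mem_closedBall.1 hv).trans_lt hrρ)).1
    simp [hs0.ne', this]
  · simpa [hs0.ne'] using hzero

/-! ### Application to `Ξ_t`. -/

theorem Xi_eq_cosTransform (D : ℕ) (t : ℝ) :
    Xi D t = cosTransform (volume.restrict (Set.Ioi 0))
      (fun u => Real.exp (t * u ^ 2) * Phi D u) := rfl

/-- If `Ξ_t` has only real zeros for all `t ≥ s`, then the real zeros of `Ξ_t` are simple for all
`t > s`. -/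
theorem deriv_Xi_ne_zero {D : ℕ} (hD : 0 < D) {s t : ℝ} (hst : s < t)
    (hs : ∀ t' : ℝ, s ≤ t' → HasOnlyRealZeros (Xi D t')) {x : ℝ} (hx : Xi D t x = 0) :
    deriv (Xi D t) x ≠ 0 := by
  intro hx'
  have hΨ : ∀ a : ℝ, Integrable
      (fun u => Real.exp (a * u ^ 2) * (Real.exp (t * u ^ 2) * Phi D u))
      (volume.restrict (Set.Ioi 0)) := fun a => by
    refine (integrableOn_exp_mul_sq_mul_Phi hD (a + t)).congr (.of_forall fun u => ?_)
    simp only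
    rw [← mul_assoc, ← Real.exp_add]
    ring_nf
  -- Having only real zeros, `Ξ_t` cannot vanish at `i`.
  have hne : ∃ z, Xi D t z ≠ 0 :=
    ⟨Complex.I, fun h => by simpa using hs t hst.le _ h⟩
  rw [Xi_eq_cosTransform] at hx hx' hne
  have hsmall : ∀ᶠ r : ℝ in nhdsWithin 0 (Set.Ioi 0), s < t - r ^ 2 := by
    refine nhdsWithin_le_nhds (Filter.Tendsto.eventually_const_lt hst ?_)
    exact Continuous.tendsto' (by fun_prop) _ _ (by simp)
  obtain ⟨r, ⟨z, hz, hzero⟩, hr⟩ :=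
    ((eventually_exists_nonreal_zero hΨ hne hx hx').and hsmall).exists
  refine hz (hs (t - r ^ 2) hr.le z ?_)
  rw [Xi_eq_cosTransform, ← hzero]
  congr 1
  funext u
  rw [← mul_assoc, ← Real.exp_add]
  ring_nf

/-- Above the threshold all zeros of `Ξ_t` are real and simple. -/
theorem zeros_real_and_simple {D : ℕ} (hD : 0 < D) {t : ℝ} (ht : newmanConstant D < (t : EReal))
    {z : ℂ} (hz : Xi D t z = 0) : z.im = 0 ∧ deriv (Xi D t) z ≠ 0 := by
  obtain ⟨_, ⟨s, hs, rfl⟩, hst⟩ := sInf_lt_iff.1 ht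
  have hst : s < t := EReal.coe_lt_coe_iff.1 hst
  have him := hs t hst.le z hz
  refine ⟨him, ?_⟩
  obtain ⟨x, rfl⟩ : ∃ x : ℝ, (x : ℂ) = z := ⟨z.re, Complex.ext (by simp) (by simp [him])⟩
  exact deriv_Xi_ne_zero hD hst hs hz

end LowDiscriminant

end

theorem mainTheorem5 (D : ℕ) (hD : 0 < D)
    (hfund : LowDiscriminant.IsFundamentalDiscriminant (-(D : ℤ))) :
    (∀ t₀ x₀ : ℝ,
      LowDiscriminant.Xi D t₀ (x₀ : ℂ) = 0 →
      deriv (LowDiscriminant.Xi D t₀) (x₀ : ℂ) = 0 →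
      (t₀ : EReal) ≤ LowDiscriminant.newmanConstant D) ∧
    (∀ t : ℝ, LowDiscriminant.newmanConstant D < (t : EReal) →
      ∀ z : ℂ, LowDiscriminant.Xi D t z = 0 →
        z.im = 0 ∧ deriv (LowDiscriminant.Xi D t) z ≠ 0) := by
  refine ⟨fun t₀ x₀ h h' => ?_, fun t ht z hz => LowDiscriminant.zeros_real_and_simple hD ht hz⟩
  by_contra! hlt
  exact (LowDiscriminant.zeros_real_and_simple hD hlt h).2 h'
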